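/- There is a universal constant $c_{\mathrm{par}}>0$, admissible in Lévy's inequality on all unit spheres (that is, for every $M\ge 1$, every $L$-Lipschitz $f:S^{M-1}\to\mathbb R$ with $L>0$ and every $\tau>0$, $\Pr_{\theta\sim\mu_S}(|f(\theta)-\mathbb E_{\mu_S}f|\ge\tau)\le 2\exp(-c_{\mathrm{par}}M\tau^2/L^2)$, where $\mu_S$ is the uniform probability measure on $S^{M-1}=\{\theta\in\mathbb R^M:\|\theta\|_2=1\}$ and Lipschitz refers to the Euclidean distance), such that the following holds. Let $\mathcal H$ be a finite-dimensional complex Hilbert space. A GKSL generator is a linear map $\mathcal L$ on $\mathcal B(\mathcal H)$ that preserves Hermiticity, satisfies $\operatorname{Tr}\mathcal L(A)=0$ for all $A$, and for which $e^{s\mathcal L}$ is completely positive and trace preserving for all $s\ge 0$. Let $\mathcal L_{\mathrm{ref}}$ be a GKSL generator, $G_1,\dots,G_M$ linear maps on $\mathcal B(\mathcal H)$ with $\|G_j\|_{1\to1}\le C_G$ for all $j$ (norm induced by the trace norm), $C_G>0$, $\delta>0$, and $$\mathcal L(\theta)=\mathcal L_{\mathrm{ref}}+\frac{\delta}{\sqrt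 M}\sum_{j=1}^M\theta_jG_j .$$ Let $\Theta\subseteq S^{M-1}$ be nonempty with $\mathcal L(\theta)$ a GKSL generator for all $\theta\in\Theta$, and let $\mu_\Theta$ be the normalized restriction of $\mu_S$ to $\Theta$. Fix $t>0$, a density operator $\rho_{\mathrm{in}}$, a POVM $\{M_x\}_{x\in X}$ with $X$ finite, and a probability distribution $Q$ on $X$. Put $P_{\mathcal L}(x)=\operatorname{Tr}\bigl(M_x e^{t\mathcal L}(\rho_{\mathrm{in}})\bigr)$, $d_{\mathrm{TV}}(P,Q)=\frac12\sum_x|P(x)-Q(x)|$, $L_0=t\delta C_G$ and $L_{\mathrm{TV}}=L_0/2$. (1) For all $\theta,\theta'\in\Theta$, $\bigl|d_{\mathrm{TV}}(P_{\mathcal L(\theta)},Q)-d_{\mathrm{TV}}(P_{\mathcal L(\theta')},Q)\bigr|\le L_{\mathrm{TV}}\|\theta-\theta'\|_2$. (2) Suppose in addition that $\Theta$ has full measure, $\mu_S(S^{M-1}\setminus\Theta)=0$, and that $\mathbb E_{\theta\sim\mu_\Theta}d_{\mathrm{TV}}(P_{\mathcal L(\theta)},Q)\in[m_0-\epsilon_{\mathrm{mean}},m_0+\epsilon_{\mathrm{mean}}]$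 with $m_0>0$. Then for every $\xi>0$, $$\Pr_{\theta\sim\mu_\Theta}\bigl(|d_{\mathrm{TV}}(P_{\mathcal L(\theta)},Q)-m_0|\ge\xi+\epsilon_{\mathrm{mean}}\bigr)\le 2\exp\!\Bigl(-c_{\mathrm{par}}\frac{M\xi^2}{L_{\mathrm{TV}}^2}\Bigr).$$ (3) Under the assumptions of (2), if $\epsilon_{\mathrm{mean}}\le m_0/4$, then $\{\theta: d_{\mathrm{TV}}(P_{\mathcal L(\theta)},Q)\le m_0/2\}\subseteq\{\theta: |d_{\mathrm{TV}}(P_{\mathcal L(\theta)},Q)-m_0|\ge m_0/2\}$ and $$\Pr_{\theta\sim\mu_\Theta}\Bigl(d_{\mathrm{TV}}(P_{\mathcal L(\theta)},Q)\le\frac{m_0}{2}\Bigr)\le 2\exp\!\Bigl(-c_{\mathrm{par}}\frac{M\,m_0^2}{16L_{\mathrm{TV}}^2}\Bigr).$$ -/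

import Mathlib

open MeasureTheory
open scoped ENNReal CStarAlgebra

noncomputable section

namespace OpenSystem

section Quantum

/-- The algebra `B(H)` of operators on a finite-dimensional Hilbert space `H`, with its adjoint,
its operator norm and its Loewner order. -/
abbrev Op (H : Type*) [NormedAddCommGroup H] [InnerProductSpace ℂ H] := H →L[ℂ] H

/-- Continuous linear endomorphisms of a normed space. -/
abbrev LinEnd (V : Type*) [NormedAddCommGroup V] [NormedSpace ℂ V] := V →L[ℂ] V

/-- Super-operators, i.e. linear maps `B(H) → B(H)` (all continuous when `H` is
finite-dimensional). -/
abbrev SuperOp (H : Type*) [NormedAddCommGroup H] [InnerProductSpace ℂ H] := LinEnd (Op H)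

variable {H : Type*} [NormedAddCommGroup H] [InnerProductSpace ℂ H] [CompleteSpace H]

/-- The trace of an operator. -/
def tr (A : Op H) : ℂ := LinearMap.trace ℂ H A.toLinearMap

/-- The trace norm `‖A‖₁ = Tr √(A† A)`. -/
def traceNorm (A : Op H) : ℝ := (tr (CFC.sqrt (star A * A))).re

/-- The induced norm `‖T‖_{1→1} = sup_{A ≠ 0} ‖T A‖₁ / ‖A‖₁`, as an extended non-negative
number. -/
def inducedOneNorm (T : SuperOp H) : ℝ≥0∞ :=
  ⨆ (A : Op H) (_ : A ≠ 0), ENNReal.ofReal (traceNorm (T A) / traceNorm A)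

/-- `T` is completely positive and trace preserving. -/
def IsCPTP (T : SuperOp H) : Prop :=
  (∃ Φ : Op H →CP Op H, ∀ A, Φ A = T A) ∧ ∀ A, tr (T A) = tr A

/-- The evolution `Λ_t = e^{tL}`. -/
def evolution (L : SuperOp H) (t : ℝ) : SuperOp H := NormedSpace.exp ((t : ℂ) • L)

/-- `L` is a GKSL generator (Lindbladian): it preserves Hermiticity, the flow it generates
preserves the trace (on the level of the generator: `Tr L(A) = 0`), and `e^{tL}` is completely
positive and trace preserving for every `t ≥ 0`. -/
structure IsGKSL (L : SuperOp H) : Prop where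
  isSelfAdjoint_map : ∀ A : Op H, IsSelfAdjoint A → IsSelfAdjoint (L A)
  tr_map : ∀ A : Op H, tr (L A) = 0
  isCPTP_evolution : ∀ t : ℝ, 0 ≤ t → IsCPTP (evolution L t)

/-- Density operators. -/
def IsState (ρ : Op H) : Prop := 0 ≤ ρ ∧ tr ρ = 1

/-- Positive operator valued measures with finite outcome set `X`. -/
def IsPOVM {X : Type*} [Fintype X] (E : X → Op H) : Prop :=
  (∀ x, 0 ≤ E x) ∧ ∑ x, E x = 1

/-- The output distribution `P_L(x) = Tr(E_x e^{tL}(ρ))`; for a GKSL generator, a state and a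
POVM these traces are real. -/
def outputDist {X : Type*} (t : ℝ) (ρ : Op H) (E : X → Op H) (L : SuperOp H) (x : X) : ℝ :=
  (tr (E x * evolution L t ρ)).re

end Quantum

/-- Total variation distance on a finite set. -/
def dTV {X : Type*} [Fintype X] (P Q : X → ℝ) : ℝ := (1 / 2) * ∑ x, |P x - Q x|

/-- The unit sphere `S^{M-1}` of `ℝ^M`, with the Euclidean distance. -/
abbrev ParamSphere (M : ℕ) : Type := Metric.sphere (0 : EuclideanSpace ℝ (Fin M)) 1

/-- The uniform probability measure on `S^{M-1}` (`M ≥ 1`): normalized surface measure. -/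
def sphereMeasure (M : ℕ) : Measure (ParamSphere M) :=
  ((volume : Measure (EuclideanSpace ℝ (Fin M))).toSphere Set.univ)⁻¹ •
    (volume : Measure (EuclideanSpace ℝ (Fin M))).toSphere

/-- The normalized restriction `μ_Θ` of the uniform measure to `Θ`. -/
def paramMeasure {M : ℕ} (Θ : Set (ParamSphere M)) : Measure (ParamSphere M) :=
  (sphereMeasure M Θ)⁻¹ • (sphereMeasure M).restrict Θ

/-- `c` is an admissible constant in Lévy's inequality (around the mean), for all spheres
`S^{M-1}`, all Lipschitz functions and all deviations. -/
def IsLevyConstant (c : ℝ) : Prop :=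
  ∀ (M : ℕ), 1 ≤ M → ∀ (f : ParamSphere M → ℝ) (L τ : ℝ), 0 < L → 0 < τ →
    (∀ θ θ', |f θ - f θ'| ≤ L * dist θ θ') →
    (sphereMeasure M).real {θ | τ ≤ |f θ - ∫ η, f η ∂sphereMeasure M|}
      ≤ 2 * Real.exp (-c * (M * τ ^ 2 / L ^ 2))

section Ensemble

variable {H : Type*} [NormedAddCommGroup H] [InnerProductSpace ℂ H] [CompleteSpace H] {M : ℕ}

/-- The parametrized generator `L(θ) = L_ref + (δ / √M) ∑ⱼ θⱼ Gⱼ`. -/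
def generator (Lref : SuperOp H) (G : Fin M → SuperOp H) (δ : ℝ) (θ : ParamSphere M) :
    SuperOp H :=
  Lref + ((δ / √(M : ℝ) : ℝ) : ℂ) • ∑ j, (((θ : EuclideanSpace ℝ (Fin M)) j : ℝ) : ℂ) • G j

/-- The function `θ ↦ d_TV(P_{L(θ)}, Q)`. -/
def tvToRef {X : Type*} [Fintype X] (Lref : SuperOp H) (G : Fin M → SuperOp H) (δ t : ℝ)
    (ρ : Op H) (E : X → Op H) (Q : X → ℝ) (θ : ParamSphere M) : ℝ :=
  dTV (outputDist t ρ E (generator Lref G δ θ)) Q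

end Ensemble

end OpenSystem

end

/-! Two independent facts combine: Lévy's inequality, proved here from Gaussian concentration, and a
Lipschitz bound for the output statistics, proved by Duhamel's formula.

Lévy: for independent Gaussian vectors `X`, `Y`, the rotation path from `X` to `Y` has, at every
angle, a position and a velocity that are again independent standard Gaussians. Averaging over the
angle bounds the exponential moments of `F Y - F X` for smooth, then Lipschitz, `F` (Maurey-Pisier).
A centred Lipschitz `f` on the sphere is extended homogeneously of degree one. Since a Gaussian is a
uniform direction times an independent radius of mean at least a constant times `√M`, Jensen in the
radius turns the Gaussian bound into a sub-Gaussian bound for `f` with variance proxy of order `L ^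
2 / M`; Chernoff finishes (`hasSubgaussianMGF_sphereMeasure`, `exists_isLevyConstant`).

Lipschitz bound: the derivative of `e^{(t-s)L} e^{sL'}` is `e^{(t-s)L} (L' - L) e^{sL'}`. On a state
it is a channel applied to a Hermitian operator, and measuring the result yields an `ℓ¹` norm
controlled by trace norms of the `G j` on states (`sum_abs_re_tr_mul_le`,
`sum_abs_outputDist_sub_le`). Cauchy-Schwarz over the parameters cancels the `1 / √M`.

The Lipschitz bound holds only on `Θ`, so the function is extended from `Θ` to the whole sphere
before Lévy is applied; full measure makes the extension harmless. -/

noncomputable section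

namespace OpenSystem

/-! ### Gaussian concentration: the Maurey-Pisier inequality -/

section GaussianConcentration

open ProbabilityTheory Real

/-- Jensen's inequality for the exponential, without integrability of the exponential. -/
theorem ofReal_exp_integral_le {α : Type*} [MeasurableSpace α] {P : Measure α}
    [IsProbabilityMeasure P] {h : α → ℝ} (hh : Integrable h P) :
    ENNReal.ofReal (exp (∫ x, h x ∂P)) ≤ ∫⁻ x, ENNReal.ofReal (exp (h x)) ∂P := by
  set a := ∫ x, h x ∂P with ha
  -- The tangent line of `exp` at the mean `a` lies below `exp` and integrates to `exp a`.
  have hi : Integrable (fun x ↦ exp a * (h x - a + 1)) P :=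
    ((hh.sub (integrable_const a)).add (integrable_const 1)).const_mul _
  have h1 : ∫ x, exp a * (h x - a + 1) ∂P = exp a := by
    have h2 : ∫ x, (h x - a) ∂P = 0 := by
      rw [integral_sub hh (integrable_const a)]; simp [← ha]
    have h3 : ∫ x, (h x - a + 1) ∂P = 1 := by
      rw [integral_add (f := fun x ↦ h x - a) (hh.sub (integrable_const a)) (integrable_const 1),
        h2]
      simp
    rw [integral_const_mul, h3, mul_one]
  calc ENNReal.ofReal (exp a) = ENNReal.ofReal (∫ x, exp a * (h x - a + 1) ∂P) := by rw [h1]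
    _ ≤ ENNReal.ofReal (∫ x, max (exp a * (h x - a + 1)) 0 ∂P) :=
      ENNReal.ofReal_le_ofReal (integral_mono hi hi.pos_part fun x ↦ le_max_left _ _)
    _ = ∫⁻ x, ENNReal.ofReal (exp a * (h x - a + 1)) ∂P := by
      rw [ofReal_integral_eq_lintegral_ofReal hi.pos_part (ae_of_all _ fun x ↦ le_max_right _ _)]
      simp
    _ ≤ ∫⁻ x, ENNReal.ofReal (exp (h x)) ∂P := by
      refine lintegral_mono fun x ↦ ENNReal.ofReal_le_ofReal ?_
      calc exp a * (h x - a + 1) ≤ exp a * exp (h x - a) := by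
            gcongr; exact add_one_le_exp _
        _ = exp (h x) := by rw [← exp_add]; congr 1; ring

variable {E : Type*} [NormedAddCommGroup E] [InnerProductSpace ℝ E] [FiniteDimensional ℝ E]
  [MeasurableSpace E] [BorelSpace E]

theorem lintegral_exp_strongDual_stdGaussian (ℓ : StrongDual ℝ E) :
    ∫⁻ x, ENNReal.ofReal (exp (ℓ x)) ∂stdGaussian E = ENNReal.ofReal (exp (‖ℓ‖ ^ 2 / 2)) := by
  have hmap := IsGaussian.map_eq_gaussianReal (μ := stdGaussian E) ℓ
  have hmgf := mgf_gaussianReal hmap 1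
  have hint : Integrable (fun x ↦ exp (ℓ x)) (stdGaussian E) := by
    have : Integrable (fun x : ℝ ↦ exp (1 * x)) ((stdGaussian E).map ℓ) := by
      rw [hmap]; exact integrable_exp_mul_gaussianReal 1
    simpa [Function.comp_def] using (integrable_map_measure (by fun_prop) (by fun_prop)).1 this
  rw [← ofReal_integral_eq_lintegral_ofReal hint (ae_of_all _ fun x ↦ (exp_pos _).le)]
  simp only [mgf, one_mul, integral_strongDual_stdGaussian, variance_dual_stdGaussian] at hmgf
  rw [hmgf]
  congr 2
  simp

/-- Makes position and velocity along the rotation path independent standard Gaussians at each fixed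
angle. -/
theorem map_rotation_stdGaussian (θ : ℝ) :
    ((stdGaussian E).prod (stdGaussian E)).map (ContinuousLinearMap.rotation θ) =
      (stdGaussian E).prod (stdGaussian E) :=
  haveI : CompleteSpace E := FiniteDimensional.complete ℝ E
  IsGaussian.map_rotation_eq_self_of_forall_strongDual_eq_zero
    (fun ℓ ↦ integral_strongDual_stdGaussian ℓ) θ

/-- The Maurey-Pisier exponential inequality for continuously differentiable functions. -/
theorem lintegral_exp_sub_stdGaussian_of_contDiff {F : E → ℝ} (hF : ContDiff ℝ 1 F) {K : ℝ}
    (hK : ∀ x, ‖fderiv ℝ F x‖ ≤ K) (a : ℝ) :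
    ∫⁻ p, ENNReal.ofReal (exp (a * (F p.2 - F p.1))) ∂(stdGaussian E).prod (stdGaussian E) ≤
      ENNReal.ofReal (exp (a ^ 2 * π ^ 2 * K ^ 2 / 8)) := by
  set μ := stdGaussian E
  have hDF : Continuous (fderiv ℝ F) := hF.continuous_fderiv one_ne_zero
  let D : E × E → ℝ := fun q ↦ a * (π / 2) * fderiv ℝ F q.1 q.2
  have hD : Continuous D := by
    have : Continuous fun q : E × E ↦ fderiv ℝ F q.1 q.2 := by fun_prop
    fun_prop
  have hrot : Continuous fun z : (E × E) × ℝ ↦ ContinuousLinearMap.rotation z.2 z.1 := by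
    simp only [ContinuousLinearMap.rotation_apply]; fun_prop
  -- The uniform law on the angles; its density `2 / π` is offset by the factor `π / 2` in `D`, so
  -- the mean of `D` along the path is exactly `a * (F p.2 - F p.1)`, and Jensen applies.
  let η : Measure ℝ := ENNReal.ofReal (2 / π) • volume.restrict (Set.Ioc 0 (π / 2))
  have hη : IsProbabilityMeasure η := ⟨by
    simp only [η, Measure.smul_apply, Measure.restrict_apply_univ, Real.volume_Ioc, smul_eq_mul,
      sub_zero]
    rw [← ENNReal.ofReal_mul (by positivity)]
    have : 2 / π * (π / 2) = 1 := by field_simp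
    simp [this]⟩
  have hpt : ∀ p : E × E, ENNReal.ofReal (exp (a * (F p.2 - F p.1))) ≤
      ∫⁻ s, ENNReal.ofReal (exp (D (ContinuousLinearMap.rotation s p))) ∂η := by
    intro p
    have hrotp : Continuous fun s : ℝ ↦ ContinuousLinearMap.rotation s p := by
      simp only [ContinuousLinearMap.rotation_apply]; fun_prop
    have hc : Continuous fun s : ℝ ↦ D (ContinuousLinearMap.rotation s p) := hD.comp hrotp
    have hint : Integrable (fun s ↦ D (ContinuousLinearMap.rotation s p)) η :=
      (hc.integrableOn_Ioc (a := 0) (b := π / 2)).smul_measure ENNReal.ofReal_ne_top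
    have hftc : ∫ s, D (ContinuousLinearMap.rotation s p) ∂η = a * (F p.2 - F p.1) := by
      have hderiv : ∀ s ∈ Set.uIcc (0 : ℝ) (π / 2), HasDerivAt
          (fun s ↦ a * (π / 2) * F (ContinuousLinearMap.rotation s p).1)
          (D (ContinuousLinearMap.rotation s p)) s := by
        intro s _
        refine HasDerivAt.const_mul (a * (π / 2)) ?_
        have h1 : HasDerivAt (fun s ↦ (ContinuousLinearMap.rotation s p).1)
            (ContinuousLinearMap.rotation s p).2 s := by
          simp only [ContinuousLinearMap.rotation_apply]
          exact ((hasDerivAt_cos s).smul_const p.1).add ((hasDerivAt_sin s).smul_const p.2)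
        exact ((hF.differentiable one_ne_zero _).hasFDerivAt.comp_hasDerivAt s h1)
      have := intervalIntegral.integral_eq_sub_of_hasDerivAt hderiv (hc.intervalIntegrable _ _)
      rw [intervalIntegral.integral_of_le (by positivity)] at this
      rw [integral_smul_measure, this, ENNReal.toReal_ofReal (by positivity)]
      simp only [ContinuousLinearMap.rotation_apply, cos_pi_div_two, sin_pi_div_two, cos_zero,
        sin_zero, smul_eq_mul]
      simp only [zero_smul, one_smul, zero_add, add_zero]
      field_simp
    rw [← hftc]
    exact ofReal_exp_integral_le hint
  have hmeas : Measurable fun z : (E × E) × ℝ ↦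
      ENNReal.ofReal (exp (D (ContinuousLinearMap.rotation z.2 z.1))) :=
    (continuous_exp.comp (hD.comp hrot)).measurable.ennreal_ofReal
  calc _ ≤ ∫⁻ p, ∫⁻ s, ENNReal.ofReal (exp (D (ContinuousLinearMap.rotation s p))) ∂η ∂μ.prod μ :=
        lintegral_mono hpt
    _ = ∫⁻ s, ∫⁻ p, ENNReal.ofReal (exp (D (ContinuousLinearMap.rotation s p))) ∂μ.prod μ ∂η :=
        lintegral_lintegral_swap hmeas.aemeasurable
    _ ≤ ∫⁻ _s, ENNReal.ofReal (exp (a ^ 2 * π ^ 2 * K ^ 2 / 8)) ∂η := by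
        refine lintegral_mono fun s ↦ ?_
        have hDm : Measurable fun q ↦ ENNReal.ofReal (exp (D q)) := by
          exact (continuous_exp.comp hD).measurable.ennreal_ofReal
        rw [← lintegral_map hDm (ContinuousLinearMap.measurable _), map_rotation_stdGaussian,
          lintegral_prod _ hDm.aemeasurable]
        calc _ ≤ ∫⁻ _x, ENNReal.ofReal (exp (a ^ 2 * π ^ 2 * K ^ 2 / 8)) ∂μ := by
              -- With the position `x` frozen, `D` is a linear functional of the Gaussian velocity,
              -- whose exponential moment is explicit.
              refine lintegral_mono fun x ↦ ?_
              have := lintegral_exp_strongDual_stdGaussian ((a * (π / 2)) • fderiv ℝ F x)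
              simp only [FunLike.coe_smul, Pi.smul_apply, smul_eq_mul] at this
              rw [this]
              refine ENNReal.ofReal_le_ofReal (exp_le_exp.2 ?_)
              rw [norm_smul, mul_pow, Real.norm_eq_abs, sq_abs]
              have : ‖fderiv ℝ F x‖ ^ 2 ≤ K ^ 2 := by gcongr; exact hK x
              calc (a * (π / 2)) ^ 2 * ‖fderiv ℝ F x‖ ^ 2 / 2
                  ≤ (a * (π / 2)) ^ 2 * K ^ 2 / 2 := by gcongr
                _ = a ^ 2 * π ^ 2 * K ^ 2 / 8 := by ring
          _ = _ := by simp
    _ = _ := by simp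

open scoped NNReal Convolution in
/-- Lipschitz functions are uniformly approximated by smooth functions with the same constant. -/
theorem exists_contDiff_dist_le_of_lipschitzWith {F : E → ℝ} {K : ℝ≥0} (hF : LipschitzWith K F)
    {ε : ℝ} (hε : 0 < ε) :
    ∃ G : E → ℝ, ContDiff ℝ 1 G ∧ (∀ x, ‖fderiv ℝ G x‖ ≤ K) ∧ ∀ x, |G x - F x| ≤ ε := by
  obtain ⟨r, hr, hKr⟩ : ∃ r : ℝ, 0 < r ∧ K * r ≤ ε := by
    refine ⟨ε / (K + 1), by positivity, ?_⟩
    rw [mul_div_assoc', div_le_iff₀ (by positivity)]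
    nlinarith
  -- Mollifying at scale `r` moves `F` by at most `K * r` and preserves its Lipschitz constant.
  let φ : ContDiffBump (0 : E) := ⟨r / 2, r, by positivity, by linarith⟩
  have hloc : LocallyIntegrable F (volume : Measure E) := hF.continuous.locallyIntegrable
  have hconv : ∀ x, ConvolutionExistsAt (φ.normed volume) F x (ContinuousLinearMap.lsmul ℝ ℝ)
      volume := fun x ↦ φ.hasCompactSupport_normed.convolutionExists_left _
        φ.continuous_normed hloc x
  have hlip : LipschitzWith K (φ.normed volume ⋆[ContinuousLinearMap.lsmul ℝ ℝ, volume] F) := by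
    refine LipschitzWith.of_dist_le_mul fun x y ↦ ?_
    rw [Real.dist_eq, convolution, convolution, ← integral_sub (hconv x) (hconv y),
      ← Real.norm_eq_abs]
    calc _ ≤ ∫ t, φ.normed volume t * (K * dist x y) := by
          have hi : Integrable (fun t ↦ φ.normed volume t * (K * dist x y)) volume :=
            φ.integrable_normed.mul_const _
          refine norm_integral_le_of_norm_le hi (ae_of_all _ ?_)
          intro t
          change ‖φ.normed volume t * F (x - t) - φ.normed volume t * F (y - t)‖ ≤ _
          rw [← mul_sub, norm_mul, Real.norm_of_nonneg (φ.nonneg_normed t)]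
          refine mul_le_mul_of_nonneg_left ?_ (φ.nonneg_normed t)
          simpa [Real.dist_eq] using hF.dist_le_mul (x - t) (y - t)
      _ = _ := by rw [integral_mul_const, φ.integral_normed, one_mul]
  refine ⟨φ.normed volume ⋆[ContinuousLinearMap.lsmul ℝ ℝ, volume] F, ?_, ?_, ?_⟩
  · exact φ.hasCompactSupport_normed.contDiff_convolution_left _ φ.contDiff_normed hloc
  · exact fun x ↦ norm_fderiv_le_of_lipschitz ℝ (x₀ := x) hlip
  · intro x
    rw [← Real.dist_eq]
    refine φ.dist_normed_convolution_le hF.continuous.aestronglyMeasurable fun y hy ↦ ?_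
    refine (hF.dist_le_mul y x).trans (le_trans ?_ hKr)
    gcongr
    exact (Metric.mem_ball.1 hy).le

open scoped NNReal in
/-- The Maurey-Pisier exponential inequality for Lipschitz functions. -/
theorem lintegral_exp_sub_stdGaussian_of_lipschitzWith {F : E → ℝ} {K : ℝ≥0}
    (hF : LipschitzWith K F) (a : ℝ) :
    ∫⁻ p, ENNReal.ofReal (exp (a * (F p.2 - F p.1))) ∂(stdGaussian E).prod (stdGaussian E) ≤
      ENNReal.ofReal (exp (a ^ 2 * π ^ 2 * K ^ 2 / 8)) := by
  have key : ∀ ε : ℝ, 0 < ε →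
      ∫⁻ p, ENNReal.ofReal (exp (a * (F p.2 - F p.1))) ∂(stdGaussian E).prod (stdGaussian E) ≤
      ENNReal.ofReal (exp (2 * |a| * ε) * exp (a ^ 2 * π ^ 2 * K ^ 2 / 8)) := by
    intro ε hε
    obtain ⟨G, hG, hGK, hGF⟩ := exists_contDiff_dist_le_of_lipschitzWith hF hε
    calc _ ≤ ∫⁻ p, ENNReal.ofReal (exp (2 * |a| * ε)) *
          ENNReal.ofReal (exp (a * (G p.2 - G p.1))) ∂(stdGaussian E).prod (stdGaussian E) := by
          refine lintegral_mono fun p ↦ ?_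
          rw [← ENNReal.ofReal_mul (exp_pos _).le, ← exp_add]
          refine ENNReal.ofReal_le_ofReal (exp_le_exp.2 ?_)
          have h1 : |(F p.2 - F p.1) - (G p.2 - G p.1)| ≤ 2 * ε := by
            have h2 := abs_le.1 (hGF p.2)
            have h3 := abs_le.1 (hGF p.1)
            rw [abs_le]; constructor <;> linarith
          have h4 : a * ((F p.2 - F p.1) - (G p.2 - G p.1)) ≤ |a| * (2 * ε) :=
            (le_abs_self _).trans (by rw [abs_mul]; gcongr)
          linarith
      _ ≤ _ := by
          rw [lintegral_const_mul' _ _ ENNReal.ofReal_ne_top, ENNReal.ofReal_mul (exp_pos _).le]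
          gcongr
          exact lintegral_exp_sub_stdGaussian_of_contDiff hG hGK a
  have hlim : Filter.Tendsto (fun ε : ℝ ↦ ENNReal.ofReal
      (exp (2 * |a| * ε) * exp (a ^ 2 * π ^ 2 * K ^ 2 / 8))) (nhdsWithin 0 (Set.Ioi 0))
      (nhds (ENNReal.ofReal (exp (a ^ 2 * π ^ 2 * K ^ 2 / 8)))) := by
    have : Continuous fun ε : ℝ ↦ ENNReal.ofReal
      (exp (2 * |a| * ε) * exp (a ^ 2 * π ^ 2 * K ^ 2 / 8)) :=
      ENNReal.continuous_ofReal.comp (by fun_prop)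
    simpa using (this.tendsto 0).mono_left nhdsWithin_le_nhds
  exact ge_of_tendsto hlim (Filter.eventually_of_mem self_mem_nhdsWithin fun ε hε ↦ key ε hε)

end GaussianConcentration

/-! ### From Gaussian measure to the sphere: Lévy's inequality -/

section SphereConcentration

open ProbabilityTheory Real

variable {E : Type*} [NormedAddCommGroup E] [InnerProductSpace ℝ E] [FiniteDimensional ℝ E]
  [MeasurableSpace E] [BorelSpace E]

/-- Both sides have the same characteristic function. The density depends only on the norm, which is
what separates direction from radius. -/
theorem stdGaussian_eq_withDensity :
    stdGaussian E = (volume : Measure E).withDensity fun x ↦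
      ENNReal.ofReal ((2 * π) ^ (-(Module.finrank ℝ E / 2 : ℝ)) * exp (-(1 / 2) * ‖x‖ ^ 2)) := by
  set c : ℝ := (2 * π) ^ (-(Module.finrank ℝ E / 2 : ℝ)) with hc
  have hc0 : 0 < c := by positivity
  have hG : ∫ x : E, exp (-(1 / 2) * ‖x‖ ^ 2) = c⁻¹ := by
    rw [GaussianFourier.integral_rexp_neg_mul_sq_norm (by norm_num : (0 : ℝ) < 1 / 2), hc,
      Real.rpow_neg (by positivity), inv_inv]
    congr 1; field_simp
  have hGi : Integrable fun x : E ↦ exp (-(1 / 2) * ‖x‖ ^ 2) := by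
    refine Integrable.of_integral_ne_zero ?_
    rw [hG]; positivity
  have hfin : IsFiniteMeasure ((volume : Measure E).withDensity fun x ↦
      ENNReal.ofReal (c * exp (-(1 / 2) * ‖x‖ ^ 2))) :=
    isFiniteMeasure_withDensity_ofReal (hGi.const_mul c).2
  have : CompleteSpace E := FiniteDimensional.complete ℝ E
  refine Measure.ext_of_charFun ?_
  ext t
  rw [charFun_stdGaussian, charFun_apply,
    integral_withDensity_eq_integral_toReal_smul (by fun_prop) (by simp)]
  have hpt : ∀ x : E, (ENNReal.ofReal (c * exp (-(1 / 2) * ‖x‖ ^ 2))).toReal •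
      Complex.exp (inner ℝ x t * Complex.I) =
      (c : ℂ) * Complex.exp (-(1 / 2 : ℂ) * ‖x‖ ^ 2 + Complex.I * inner ℝ t x) := by
    intro x
    rw [ENNReal.toReal_ofReal (by positivity), Complex.real_smul, Complex.exp_add,
      real_inner_comm t x]
    push_cast
    ring_nf
  simp_rw [hpt]
  rw [integral_const_mul, GaussianFourier.integral_cexp_neg_mul_sq_norm_add (by norm_num)]
  have h1 : ((π : ℂ) / (1 / 2)) ^ (Module.finrank ℝ E / 2 : ℂ) = ((c⁻¹ : ℝ) : ℂ) := by
    rw [hc, Real.rpow_neg (by positivity), inv_inv, Complex.ofReal_cpow (by positivity)]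
    push_cast
    congr 1; ring
  rw [h1, ← mul_assoc, ← Complex.ofReal_mul, mul_inv_cancel₀ hc0.ne', Complex.ofReal_one, one_mul]
  congr 1
  rw [Complex.I_sq]; ring

/-- Integration in polar coordinates. -/
theorem lintegral_eq_lintegral_toSphere_prod [Nontrivial E] {f : E → ℝ≥0∞} (hf : Measurable f) :
    ∫⁻ x, f x = ∫⁻ θ, ∫⁻ r, f ((r : ℝ) • (θ : E))
      ∂Measure.volumeIoiPow (Module.finrank ℝ E - 1) ∂(volume : Measure E).toSphere := by
  have hm : Measurable fun p : Metric.sphere (0 : E) 1 × Set.Ioi (0 : ℝ) ↦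
      f ((p.2 : ℝ) • (p.1 : E)) := hf.comp (by fun_prop)
  rw [← lintegral_prod _ hm.aemeasurable,
    ← (volume : Measure E).measurePreserving_homeomorphUnitSphereProd.lintegral_comp hm]
  calc ∫⁻ x, f x = ∫⁻ x in ({0}ᶜ : Set E), f x := by rw [restrict_compl_singleton]
    _ = ∫⁻ x : ({0}ᶜ : Set E), f x ∂(volume : Measure E).comap Subtype.val :=
      (lintegral_subtype_comap (measurableSet_singleton _).compl f).symm
    _ = _ := by
      refine lintegral_congr fun x ↦ ?_
      have hx : ‖(x : E)‖ ≠ 0 := norm_ne_zero_iff.2 x.2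
      simp [smul_smul, hx]

/-- Polar decomposition of the standard Gaussian measure. -/
theorem exists_stdGaussian_eq_map_smul (M : ℕ) (hM : 1 ≤ M) :
    IsProbabilityMeasure (sphereMeasure M) ∧
    ∃ ν : Measure (Set.Ioi (0 : ℝ)), IsProbabilityMeasure ν ∧
      ((sphereMeasure M).prod ν).map
        (fun p ↦ (p.2 : ℝ) • (p.1 : EuclideanSpace ℝ (Fin M))) =
        stdGaussian (EuclideanSpace ℝ (Fin M)) := by
  have : Nonempty (Fin M) := ⟨⟨0, hM⟩⟩
  set V := EuclideanSpace ℝ (Fin M)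
  set σ := (volume : Measure V).toSphere
  have hσ0 : σ Set.univ ≠ 0 := by
    rw [Ne, Measure.measure_univ_eq_zero]
    exact Measure.toSphere_ne_zero (volume : Measure V)
  have hσt : σ Set.univ ≠ ∞ := measure_ne_top _ _
  have hσP : IsProbabilityMeasure (sphereMeasure M) :=
    ⟨by simp only [sphereMeasure, Measure.smul_apply, smul_eq_mul]
        exact ENNReal.inv_mul_cancel hσ0 hσt⟩
  refine ⟨hσP, ?_⟩
  let d : ℝ → ℝ≥0∞ := fun r ↦
    ENNReal.ofReal ((2 * π) ^ (-(Module.finrank ℝ V / 2 : ℝ)) * exp (-(1 / 2) * r ^ 2))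
  have hd : Measurable d := by fun_prop
  let τ := Measure.volumeIoiPow (Module.finrank ℝ V - 1)
  -- The law of the radius; the factor `σ Set.univ` undoes the normalization in `sphereMeasure`. Its
  -- total mass is read off at the end from the pushforward identity.
  let ν : Measure (Set.Ioi (0 : ℝ)) := σ Set.univ • τ.withDensity fun r ↦ d r
  have hdm : Measurable fun r : Set.Ioi (0 : ℝ) ↦ d r := by fun_prop
  have hmap : ((sphereMeasure M).prod ν).map
        (fun p ↦ (p.2 : ℝ) • (p.1 : V)) = stdGaussian V := by
    have hm : Measurable (fun p : Metric.sphere (0 : V) 1 × Set.Ioi (0 : ℝ) ↦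
        (p.2 : ℝ) • (p.1 : V)) := by fun_prop
    refine Measure.ext_of_lintegral _ fun f hf ↦ ?_
    rw [lintegral_map hf hm, stdGaussian_eq_withDensity,
      lintegral_withDensity_eq_lintegral_mul _ (by fun_prop) hf,
      lintegral_eq_lintegral_toSphere_prod ((by fun_prop : Measurable fun x : V ↦ d ‖x‖).mul hf),
      lintegral_prod (fun p : Metric.sphere (0 : V) 1 × Set.Ioi (0 : ℝ) ↦
        f ((p.2 : ℝ) • (p.1 : V))) (hf.comp hm).aemeasurable, sphereMeasure, lintegral_smul_measure]
    simp only [ν]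
    simp_rw [lintegral_smul_measure]
    simp only [smul_eq_mul]
    rw [lintegral_const_mul' _ _ hσt, ← mul_assoc, ENNReal.inv_mul_cancel hσ0 hσt, one_mul]
    refine lintegral_congr fun θ ↦ ?_
    rw [lintegral_withDensity_eq_lintegral_mul _ hdm
      (show Measurable fun r : Set.Ioi (0 : ℝ) ↦ f ((r : ℝ) • (θ : V)) from hf.comp (by fun_prop))]
    refine lintegral_congr fun r ↦ ?_
    have hr : (0 : ℝ) < r := r.2
    simp [norm_smul, abs_of_pos hr, d]
  refine ⟨ν, ⟨?_⟩, hmap⟩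
  have := congrArg (fun m ↦ m Set.univ) hmap
  simpa [Measure.map_apply (show Measurable (fun p : Metric.sphere (0 : V) 1 × Set.Ioi (0 : ℝ) ↦
        (p.2 : ℝ) • (p.1 : V)) by fun_prop) MeasurableSet.univ, Measure.prod_apply] using this


theorem integrable_norm_stdGaussian : Integrable (fun x : E ↦ ‖x‖) (stdGaussian E) :=
  have : CompleteSpace E := FiniteDimensional.complete ℝ E
  (IsGaussian.integrable_id (μ := stdGaussian E)).norm

theorem integral_abs_gaussianReal_pos : 0 < ∫ x, |x| ∂gaussianReal 0 1 := by
  have hi : Integrable (fun x : ℝ ↦ |x|) (gaussianReal 0 1) :=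
    (IsGaussian.integrable_id (μ := gaussianReal 0 1)).norm
  refine (integral_pos_iff_support_of_nonneg (fun x ↦ abs_nonneg x) hi).2 ?_
  have : Function.support (fun x : ℝ ↦ |x|) = {0}ᶜ := by ext; simp
  rw [this]
  have := nullSingletonClass_gaussianReal (μ := 0) (v := 1) one_ne_zero
  rw [prob_compl_eq_one_sub (measurableSet_singleton _), measure_singleton]
  simp

/-- Integrate `‖x‖₁ ≤ √M ‖x‖₂`, each coordinate being a standard real Gaussian. This is where the
dimension enters Lévy's exponent. -/
theorem sqrt_mul_integral_abs_le_integral_norm_stdGaussian (M : ℕ) :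
    √M * ∫ x, |x| ∂gaussianReal 0 1 ≤ ∫ x, ‖x‖ ∂stdGaussian (EuclideanSpace ℝ (Fin M)) := by
  have hcoord : ∀ i : Fin M, Integrable (fun x : EuclideanSpace ℝ (Fin M) ↦ |x i|)
      (stdGaussian (EuclideanSpace ℝ (Fin M))) ∧
      ∫ x : EuclideanSpace ℝ (Fin M), |x i| ∂stdGaussian (EuclideanSpace ℝ (Fin M)) =
        ∫ x, |x| ∂gaussianReal 0 1 := by
    intro i
    let ℓ : StrongDual ℝ (EuclideanSpace ℝ (Fin M)) := innerSL ℝ (EuclideanSpace.single i (1 : ℝ))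
    have hℓ : ∀ x, ℓ x = x i := fun x ↦ by
      simp [ℓ, EuclideanSpace.inner_single_left]
    have hmap := IsGaussian.map_eq_gaussianReal (μ := stdGaussian (EuclideanSpace ℝ (Fin M))) ℓ
    have hn : ‖ℓ‖ = 1 := by simp [ℓ]
    rw [integral_strongDual_stdGaussian, variance_dual_stdGaussian, hn] at hmap
    simp only [one_pow, toNNReal_one] at hmap
    constructor
    · refine integrable_norm_stdGaussian.mono' (by fun_prop) (ae_of_all _ fun x ↦ ?_)
      simpa using PiLp.norm_apply_le x i
    · rw [← hmap, integral_map (by fun_prop) (by fun_prop)]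
      simp [hℓ]
  rcases Nat.eq_zero_or_pos M with rfl | hM
  · simpa using integral_nonneg fun x ↦ norm_nonneg x
  have hs : 0 < √(M : ℝ) := by positivity
  have h1 : ∫ x : EuclideanSpace ℝ (Fin M), ∑ i, |x i| ∂stdGaussian (EuclideanSpace ℝ (Fin M)) =
        M * ∫ x, |x| ∂gaussianReal 0 1 := by
    rw [integral_finsetSum _ fun i _ ↦ (hcoord i).1]
    simp [(hcoord _).2]
  have h2 : ∫ x : EuclideanSpace ℝ (Fin M), ∑ i, |x i| ∂stdGaussian (EuclideanSpace ℝ (Fin M)) ≤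
      ∫ x : EuclideanSpace ℝ (Fin M), √M * ‖x‖ ∂stdGaussian (EuclideanSpace ℝ (Fin M)) := by
    refine integral_mono (integrable_finsetSum _ fun i _ ↦ (hcoord i).1)
      (integrable_norm_stdGaussian.const_mul _) fun x ↦ ?_
    refine abs_le_of_sq_le_sq' ?_ (by positivity) |>.2
    rw [mul_pow, Real.sq_sqrt (by positivity), EuclideanSpace.real_norm_sq_eq]
    simpa using sq_sum_le_card_mul_sum_sq (s := Finset.univ) (f := fun i ↦ |x i|)
  rw [h1, integral_const_mul] at h2
  refine le_of_mul_le_mul_left ?_ hs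
  rwa [← mul_assoc, Real.mul_self_sqrt (by positivity)]

/-- The extension of a function on the unit sphere to a function that is positively homogeneous
of degree one. -/
def homogeneousExtension {M : ℕ} (f : ParamSphere M → ℝ) (x : EuclideanSpace ℝ (Fin M)) : ℝ :=
  open Classical in if h : x = 0 then 0 else
    ‖x‖ * f ⟨‖x‖⁻¹ • x, by simp [norm_smul, norm_ne_zero_iff.2 h]⟩

theorem homogeneousExtension_smul {M : ℕ} (f : ParamSphere M → ℝ) (θ : ParamSphere M) {r : ℝ}
    (hr : 0 < r) :
    homogeneousExtension f (r • (θ : EuclideanSpace ℝ (Fin M))) = r * f θ := by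
  have hθ : ‖(θ : EuclideanSpace ℝ (Fin M))‖ = 1 := by simp
  have hn : ‖r • (θ : EuclideanSpace ℝ (Fin M))‖ = r := by
    rw [norm_smul, hθ, mul_one, Real.norm_of_nonneg hr.le]
  have h0 : r • (θ : EuclideanSpace ℝ (Fin M)) ≠ 0 := by
    rw [← norm_ne_zero_iff, hn]; exact hr.ne'
  rw [homogeneousExtension, dif_neg h0]
  congr 2
  ext1
  simp only [hn, smul_smul, inv_mul_cancel₀ hr.ne', one_smul]

theorem norm_mul_norm_normalize_sub_le {V : Type*} [NormedAddCommGroup V] [NormedSpace ℝ V]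
    {x y : V} (hx : x ≠ 0) (hy : y ≠ 0) :
    ‖x‖ * ‖‖x‖⁻¹ • x - ‖y‖⁻¹ • y‖ ≤ 2 * ‖x - y‖ := by
  have hx' := norm_ne_zero_iff.2 hx
  have hy' := norm_ne_zero_iff.2 hy
  calc ‖x‖ * ‖‖x‖⁻¹ • x - ‖y‖⁻¹ • y‖ = ‖‖x‖ • (‖x‖⁻¹ • x - ‖y‖⁻¹ • y)‖ := by
        rw [norm_smul, norm_norm]
    _ = ‖(x - y) + (‖y‖ - ‖x‖) • (‖y‖⁻¹ • y)‖ := by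
        congr 1
        rw [smul_sub, sub_smul, smul_smul, mul_inv_cancel₀ hx', smul_smul ‖y‖,
          mul_inv_cancel₀ hy']
        simp
    _ ≤ ‖x - y‖ + ‖x - y‖ := by
        refine (norm_add_le _ _).trans (add_le_add le_rfl ?_)
        rw [norm_smul, norm_smul, norm_inv, norm_norm, inv_mul_cancel₀ hy', mul_one,
          Real.norm_eq_abs, abs_sub_comm]
        exact abs_norm_sub_norm_le x y
    _ = _ := by ring

/-- The change of direction and the change of radius contribute `2 * L` each; the latter needs the
sup bound on `f`. -/
theorem lipschitzWith_homogeneousExtension {M : ℕ} {f : ParamSphere M → ℝ} {L : ℝ} (hL : 0 ≤ L)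
    (hf : ∀ θ θ', |f θ - f θ'| ≤ L * dist θ θ') (hb : ∀ θ, |f θ| ≤ 2 * L) :
    LipschitzWith (4 * L).toNNReal (homogeneousExtension f) := by
  have h0 : ∀ y, |homogeneousExtension f y| ≤ 4 * L * ‖y‖ := by
    intro y
    unfold homogeneousExtension
    split_ifs with h
    · simp [h]
    · rw [abs_mul, abs_norm]
      nlinarith [hb ⟨‖y‖⁻¹ • y, by simp [norm_smul, norm_ne_zero_iff.2 h]⟩, norm_nonneg y,
        mul_nonneg hL (norm_nonneg y)]
  refine LipschitzWith.of_dist_le_mul fun x y ↦ ?_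
  rw [Real.coe_toNNReal _ (by positivity), Real.dist_eq, dist_eq_norm]
  by_cases hx : x = 0
  · simpa [hx, homogeneousExtension] using h0 y
  by_cases hy : y = 0
  · simpa [hy, homogeneousExtension] using h0 x
  rw [homogeneousExtension, homogeneousExtension, dif_neg hx, dif_neg hy]
  generalize_proofs px py
  set u : ParamSphere M := ⟨‖x‖⁻¹ • x, px⟩
  set v : ParamSphere M := ⟨‖y‖⁻¹ • y, py⟩
  have huv : dist u v = ‖‖x‖⁻¹ • x - ‖y‖⁻¹ • y‖ := by
    rw [Subtype.dist_eq, dist_eq_norm]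
  calc |‖x‖ * f u - ‖y‖ * f v| = |‖x‖ * (f u - f v) + (‖x‖ - ‖y‖) * f v| := by ring_nf
    _ ≤ ‖x‖ * |f u - f v| + |‖x‖ - ‖y‖| * |f v| := by
        refine (abs_add_le _ _).trans_eq ?_
        rw [abs_mul, abs_mul, abs_norm]
    _ ≤ ‖x‖ * (L * dist u v) + ‖x - y‖ * (2 * L) := by
        gcongr
        · exact hf u v
        · exact abs_norm_sub_norm_le x y
        · exact hb v
    _ = L * (‖x‖ * ‖‖x‖⁻¹ • x - ‖y‖⁻¹ • y‖) + ‖x - y‖ * (2 * L) := by rw [huv]; ring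
    _ ≤ L * (2 * ‖x - y‖) + ‖x - y‖ * (2 * L) := by
        have := norm_mul_norm_normalize_sub_le hx hy
        gcongr ?_ + _
        exact mul_le_mul_of_nonneg_left this hL
    _ = _ := by ring

/-- Centred Lipschitz functions on the sphere are sub-Gaussian. -/
theorem hasSubgaussianMGF_sphereMeasure {M : ℕ} (hM : 1 ≤ M) {f : ParamSphere M → ℝ} {L : ℝ}
    (hL : 0 < L) (hf : ∀ θ θ', |f θ - f θ'| ≤ L * dist θ θ')
    (hmean : ∫ θ, f θ ∂sphereMeasure M = 0) :
    HasSubgaussianMGF f (4 * π ^ 2 * L ^ 2 / (M * (∫ x, |x| ∂gaussianReal 0 1) ^ 2)).toNNReal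
      (sphereMeasure M) := by
  obtain ⟨hσ, ν, hν, hmap⟩ := exists_stdGaussian_eq_map_smul M hM
  set V := EuclideanSpace ℝ (Fin M)
  set μ := stdGaussian V
  set κ := ∫ x, |x| ∂gaussianReal 0 1
  have hκ : 0 < κ := integral_abs_gaussianReal_pos
  have hM0 : (0 : ℝ) < M := by positivity
  have hfc : Continuous f := by
    refine (LipschitzWith.of_dist_le_mul (K := L.toNNReal) fun θ θ' ↦ ?_).continuous
    rw [Real.coe_toNNReal _ hL.le, Real.dist_eq]; exact hf θ θ'
  have hdist : ∀ θ θ' : ParamSphere M, dist θ θ' ≤ 2 := fun θ θ' ↦ by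
    rw [Subtype.dist_eq, dist_eq_norm]
    refine (norm_sub_le _ _).trans ?_
    simp; norm_num
  have hfi : Integrable f (sphereMeasure M) :=
    hfc.integrable_of_hasCompactSupport (HasCompactSupport.of_compactSpace f)
  -- Zero mean and diameter at most `2` bound `f` itself.
  have hb : ∀ θ, |f θ| ≤ 2 * L := by
    intro θ
    have h1 : f θ = ∫ η, (f θ - f η) ∂sphereMeasure M := by
      rw [integral_sub (integrable_const _) hfi, hmean]; simp
    rw [h1, ← Real.norm_eq_abs]
    refine (norm_integral_le_of_norm_le_const (C := 2 * L) (ae_of_all _ fun η ↦ ?_)).trans_eq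
      (by simp)
    rw [Real.norm_eq_abs]
    nlinarith [hf θ η, hdist θ η]
  set F := homogeneousExtension f
  have hF := lipschitzWith_homogeneousExtension hL.le hf hb
  have hm : Measurable (fun p : ParamSphere M × Set.Ioi (0 : ℝ) ↦ (p.2 : ℝ) • (p.1 : V)) := by
    fun_prop
  have hFm : Measurable F := hF.continuous.measurable
  have hFi : Integrable F μ := by
    refine (integrable_norm_stdGaussian.const_mul (4 * L)).mono' hFm.aestronglyMeasurable
      (ae_of_all _ fun x ↦ ?_)
    have := hF.dist_le_mul x 0
    simpa [F, homogeneousExtension, Real.coe_toNNReal _ (by positivity : (0 : ℝ) ≤ 4 * L)]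
      using this
  have hFsmul : ∀ p : ParamSphere M × Set.Ioi (0 : ℝ),
      F ((p.2 : ℝ) • (p.1 : V)) = f p.1 * (p.2 : ℝ) := fun p ↦ by
    rw [mul_comm]; exact homogeneousExtension_smul f p.1 p.2.2
  have hF0 : ∫ x, F x ∂μ = 0 := by
    rw [← hmap, integral_map hm.aemeasurable hFm.aestronglyMeasurable]
    simp_rw [hFsmul]
    rw [integral_prod_mul f (fun r : Set.Ioi (0 : ℝ) ↦ (r : ℝ)), hmean, zero_mul]
  set m := ∫ r : Set.Ioi (0 : ℝ), (r : ℝ) ∂ν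
  have hnormsmul : ∀ p : ParamSphere M × Set.Ioi (0 : ℝ),
      ‖(p.2 : ℝ) • (p.1 : V)‖ = (p.2 : ℝ) := fun p ↦ by
    have := p.2.2.out.le
    simp [norm_smul, this]
  have hri : Integrable (fun r : Set.Ioi (0 : ℝ) ↦ (r : ℝ)) ν := by
    have h1 : Integrable (fun x : V ↦ ‖x‖) μ := integrable_norm_stdGaussian
    rw [← hmap, integrable_map_measure (by fun_prop) hm.aemeasurable] at h1
    simp only [Function.comp_def, hnormsmul] at h1
    exact (Integrable.comp_snd_iff (f := fun r : Set.Ioi (0 : ℝ) ↦ (r : ℝ)) (NeZero.ne _)).1 h1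
  have hmκ : √M * κ ≤ m := by
    refine (sqrt_mul_integral_abs_le_integral_norm_stdGaussian M).trans_eq ?_
    change ∫ x, ‖x‖ ∂μ = m
    rw [← hmap, integral_map hm.aemeasurable (by fun_prop)]
    simp_rw [hnormsmul]
    rw [integral_fun_snd (fun r : Set.Ioi (0 : ℝ) ↦ (r : ℝ))]
    simp [m]
  have hm0 : 0 < m := lt_of_lt_of_le (by positivity) hmκ
  -- Jensen is used twice: to replace the mean radius `m` by the random radius, and to replace the
  -- zero mean of `F` by an independent copy, so that Maurey-Pisier applies.
  have hexp : ∀ a : ℝ, ∫⁻ θ, ENNReal.ofReal (exp (a * m * f θ)) ∂sphereMeasure M ≤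
      ENNReal.ofReal (exp (a ^ 2 * π ^ 2 * (4 * L) ^ 2 / 8)) := by
    intro a
    have hG : Measurable fun x ↦ ENNReal.ofReal (exp (a * F x)) := by fun_prop
    calc _ ≤ ∫⁻ θ, ∫⁻ r : Set.Ioi (0 : ℝ), ENNReal.ofReal (exp (a * f θ * (r : ℝ))) ∂ν
            ∂sphereMeasure M := by
          refine lintegral_mono fun θ ↦ ?_
          have := ofReal_exp_integral_le (hri.const_mul (a * f θ))
          rw [integral_const_mul] at this
          refine le_trans (le_of_eq ?_) this
          congr 2; ring
      _ = ∫⁻ x, ENNReal.ofReal (exp (a * F x)) ∂μ := by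
          rw [← hmap, lintegral_map hG hm, lintegral_prod (fun p : ParamSphere M × Set.Ioi (0 : ℝ) ↦
            ENNReal.ofReal (exp (a * F ((p.2 : ℝ) • (p.1 : V))))) (hG.comp hm).aemeasurable]
          refine lintegral_congr fun θ ↦ lintegral_congr fun r ↦ ?_
          rw [hFsmul (θ, r), mul_assoc]
      _ ≤ ∫⁻ x, ∫⁻ y, ENNReal.ofReal (exp (-a * (F y - F x))) ∂μ ∂μ := by
          refine lintegral_mono fun x ↦ ?_
          have := ofReal_exp_integral_le ((show Integrable (fun y ↦ F y - F x) μ from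
            hFi.sub (integrable_const (F x))).const_mul (-a))
          refine le_trans (le_of_eq ?_) this
          rw [integral_const_mul]
          have h2 : ∫ y, (F y - F x) ∂μ = - F x := by
            rw [integral_sub hFi (integrable_const _), hF0]; simp
          rw [h2]; congr 2; ring
      _ = ∫⁻ p, ENNReal.ofReal (exp (-a * (F p.2 - F p.1))) ∂μ.prod μ := by
          rw [lintegral_prod (fun p : V × V ↦ ENNReal.ofReal (exp (-a * (F p.2 - F p.1))))
            (by fun_prop)]
      _ ≤ _ := by
          have := lintegral_exp_sub_stdGaussian_of_lipschitzWith hF (-a)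
          rwa [Real.coe_toNNReal _ (by positivity), neg_sq] at this
  have hint : ∀ t : ℝ, Integrable (fun θ ↦ exp (t * f θ)) (sphereMeasure M) := fun t ↦
    Continuous.integrable_of_hasCompactSupport (by fun_prop) (HasCompactSupport.of_compactSpace _)
  refine ⟨hint, fun t ↦ ?_⟩
  have h1 := hexp (t / m)
  rw [div_mul_cancel₀ _ hm0.ne', ← ofReal_integral_eq_lintegral_ofReal (hint t)
    (ae_of_all _ fun θ ↦ (exp_pos _).le), ENNReal.ofReal_le_ofReal_iff (exp_pos _).le] at h1
  refine h1.trans (exp_le_exp.2 ?_)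
  rw [Real.coe_toNNReal _ (by positivity)]
  have h2 : M * κ ^ 2 ≤ m ^ 2 := by
    calc M * κ ^ 2 = (√M * κ) ^ 2 := by rw [mul_pow, Real.sq_sqrt hM0.le]
      _ ≤ m ^ 2 := by gcongr
  calc (t / m) ^ 2 * π ^ 2 * (4 * L) ^ 2 / 8 = 4 * π ^ 2 * L ^ 2 / m ^ 2 * t ^ 2 / 2 := by
        field_simp; ring
    _ ≤ _ := by gcongr

/-- Lévy's inequality holds with a universal constant. -/
theorem exists_isLevyConstant : ∃ c : ℝ, 0 < c ∧ IsLevyConstant c := by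
  set κ := ∫ x, |x| ∂gaussianReal 0 1 with hκdef
  have hκ : 0 < κ := integral_abs_gaussianReal_pos
  -- Chernoff's `τ ^ 2 / (2 * V)` with variance proxy `V = 4 * π ^ 2 * L ^ 2 / (M * κ ^ 2)`.
  refine ⟨κ ^ 2 / (8 * π ^ 2), by positivity, ?_⟩
  intro M hM f L τ hL hτ hf
  obtain ⟨hσ, -⟩ := exists_stdGaussian_eq_map_smul M hM
  have hM0 : (0 : ℝ) < M := by positivity
  have hfc : Continuous f := by
    refine (LipschitzWith.of_dist_le_mul (K := L.toNNReal) fun θ θ' ↦ ?_).continuous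
    rw [Real.coe_toNNReal _ hL.le, Real.dist_eq]; exact hf θ θ'
  have hfi : Integrable f (sphereMeasure M) :=
    hfc.integrable_of_hasCompactSupport (HasCompactSupport.of_compactSpace f)
  set A := ∫ η, f η ∂sphereMeasure M with hA
  have hsub := hasSubgaussianMGF_sphereMeasure hM (f := fun θ ↦ f θ - A) hL
    (fun θ θ' ↦ by simpa using hf θ θ')
    (by rw [integral_sub hfi (integrable_const _)]; simp [← hA])
  have h1 := hsub.measure_ge_le hτ.le
  have h2 := hsub.neg.measure_ge_le hτ.le
  have hexp : -τ ^ 2 / (2 * ((4 * π ^ 2 * L ^ 2 / (M * κ ^ 2)).toNNReal : ℝ)) =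
      -(κ ^ 2 / (8 * π ^ 2)) * (M * τ ^ 2 / L ^ 2) := by
    rw [Real.coe_toNNReal _ (by positivity)]; field_simp; ring
  rw [← hκdef, hexp] at h1 h2
  have hset : {θ | τ ≤ |f θ - A|} ⊆ {θ | τ ≤ f θ - A} ∪ {θ | τ ≤ (-fun θ ↦ f θ - A) θ} := by
    intro θ hθ
    exact le_abs.1 (show τ ≤ |f θ - A| from hθ)
  calc _ ≤ _ := measureReal_mono hset
    _ ≤ _ := measureReal_union_le _ _
    _ ≤ _ := add_le_add h1 h2
    _ = _ := by ring

end SphereConcentration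

/-! ### Traces, trace norm and measurement statistics -/

section OperatorTrace

open scoped InnerProductSpace

variable {H : Type*} [NormedAddCommGroup H] [InnerProductSpace ℂ H]
  {ι : Type*} [Fintype ι]

theorem tr_add (A B : Op H) : tr (A + B) = tr A + tr B := by simp [tr]

theorem tr_smul (c : ℂ) (A : Op H) : tr (c • A) = c * tr A := by simp [tr]

theorem tr_mul_comm (A B : Op H) : tr (A * B) = tr (B * A) :=
  LinearMap.trace_mul_comm ℂ (A : H →ₗ[ℂ] H) (B : H →ₗ[ℂ] H)

theorem tr_eq_sum_inner (e : OrthonormalBasis ι ℂ H) (A : Op H) :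
    tr A = ∑ i, ⟪e i, A (e i)⟫_ℂ := LinearMap.trace_eq_sum_inner _ e

theorem tr_sum {X : Type*} (s : Finset X) (A : X → Op H) :
    tr (∑ x ∈ s, A x) = ∑ x ∈ s, tr (A x) := by
  classical
  induction s using Finset.induction_on with
  | empty => simp [tr]
  | insert a s ha ih => rw [Finset.sum_insert ha, Finset.sum_insert ha, tr_add, ih]

theorem re_tr_nonneg [FiniteDimensional ℂ H] {A : Op H} (hA : 0 ≤ A) : 0 ≤ (tr A).re := by
  rw [tr_eq_sum_inner (stdOrthonormalBasis ℂ H), Complex.re_sum]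
  refine Finset.sum_nonneg fun i _ ↦ ?_
  exact ((ContinuousLinearMap.nonneg_iff_isPositive A).1 hA).re_inner_nonneg_right _

theorem tr_rankOne_self [FiniteDimensional ℂ H] (v : H) (hv : ‖v‖ = 1) :
    tr (InnerProductSpace.rankOne ℂ v v) = 1 := by
  rw [tr_eq_sum_inner (stdOrthonormalBasis ℂ H)]
  have := (stdOrthonormalBasis ℂ H).sum_inner_mul_inner v v
  rw [inner_self_eq_norm_sq_to_K, hv] at this
  simp only [InnerProductSpace.rankOne_apply, inner_smul_right]
  simpa using this

variable [CompleteSpace H]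

theorem traceNorm_of_nonneg {A : Op H} (hA : 0 ≤ A) : traceNorm A = (tr A).re := by
  rw [traceNorm, (IsSelfAdjoint.of_nonneg hA).star_eq, CFC.sqrt_mul_self A hA]

theorem IsCPTP.nonneg {T : SuperOp H} (hT : IsCPTP T) {A : Op H} (hA : 0 ≤ A) : 0 ≤ T A := by
  obtain ⟨⟨Φ, hΦ⟩, -⟩ := hT
  rw [← hΦ]
  exact map_nonneg Φ hA

theorem IsState.map {T : SuperOp H} (hT : IsCPTP T) {ρ : Op H} (hρ : IsState ρ) :
    IsState (T ρ) := ⟨hT.nonneg hρ.1, (hT.2 ρ).trans hρ.2⟩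

theorem traceNorm_apply_le_of_isState {G : SuperOp H} {C : ℝ} (hC : 0 < C)
    (hG : inducedOneNorm G ≤ ENNReal.ofReal C) {ρ : Op H} (hρ : IsState ρ) :
    traceNorm (G ρ) ≤ C := by
  have hρ0 : ρ ≠ 0 := by
    rintro rfl
    simpa [tr] using hρ.2
  have h1 : traceNorm ρ = 1 := by rw [traceNorm_of_nonneg hρ.1, hρ.2, Complex.one_re]
  have h2 := (le_iSup₂ (f := fun (A : Op H) (_ : A ≠ 0) ↦
    ENNReal.ofReal (traceNorm (G A) / traceNorm A)) ρ hρ0).trans hG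
  rwa [h1, div_one, ENNReal.ofReal_le_ofReal_iff hC.le] at h2

variable [FiniteDimensional ℂ H]

/-- Spectral theorem for self-adjoint operators. -/
theorem exists_orthonormalBasis_apply_eq_smul {A : Op H} (hA : IsSelfAdjoint A) :
    ∃ (e : OrthonormalBasis (Fin (Module.finrank ℂ H)) ℂ H)
      (l : Fin (Module.finrank ℂ H) → ℝ), ∀ i, A (e i) = (l i : ℂ) • e i := by
  have hS := hA.isSymmetric
  exact ⟨hS.eigenvectorBasis rfl, hS.eigenvalues rfl, hS.apply_eigenvectorBasis rfl⟩

/-- By cyclicity the trace is that of `√B A √B`, which is positive. -/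
theorem re_tr_mul_nonneg {A B : Op H} (hA : 0 ≤ A) (hB : 0 ≤ B) : 0 ≤ (tr (A * B)).re := by
  have hS := CFC.sqrt_mul_sqrt_self B hB
  have hS0 : IsSelfAdjoint (CFC.sqrt B) := IsSelfAdjoint.of_nonneg (CFC.sqrt_nonneg B)
  rw [← hS, ← mul_assoc, tr_mul_comm, ← mul_assoc]
  exact re_tr_nonneg (hS0.conjugate_nonneg hA)

/-- Take an eigenbasis of `|A| = √(A† A)` and use `‖A v‖ = ‖|A| v‖`. -/
theorem traceNorm_eq_sum_norm (A : Op H) :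
    ∃ f : OrthonormalBasis (Fin (Module.finrank ℂ H)) ℂ H, traceNorm A = ∑ k, ‖A (f k)‖ := by
  set P := CFC.sqrt (star A * A) with hP
  have hP0 : 0 ≤ P := CFC.sqrt_nonneg _
  have hPs : IsSelfAdjoint P := IsSelfAdjoint.of_nonneg hP0
  have hPP : star P * P = star A * A := by
    rw [hPs.star_eq]; exact CFC.sqrt_mul_sqrt_self _ (star_mul_self_nonneg A)
  have hnorm : ∀ v, ‖A v‖ = ‖P v‖ := by
    have h : ∀ (B : Op H) (v : H), ‖B v‖ ^ 2 = (⟪v, (star B * B) v⟫_ℂ).re := by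
      intro B v
      rw [mul_apply_eq_comp, ContinuousLinearMap.star_eq_adjoint,
        ContinuousLinearMap.adjoint_inner_right, inner_self_eq_norm_sq_to_K]
      norm_cast
    intro v
    rw [← sq_eq_sq₀ (norm_nonneg _) (norm_nonneg _), h, h, hPP]
  obtain ⟨f, l, hf⟩ := exists_orthonormalBasis_apply_eq_smul hPs
  refine ⟨f, ?_⟩
  rw [traceNorm, ← hP, tr_eq_sum_inner f, Complex.re_sum]
  refine Finset.sum_congr rfl fun k _ ↦ ?_
  have h0 := ((ContinuousLinearMap.nonneg_iff_isPositive P).1 hP0).re_inner_nonneg_right (f k)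
  rw [hnorm, hf, inner_smul_right, norm_smul]
  rw [hf, inner_smul_right] at h0
  simp at h0 ⊢
  exact (abs_of_nonneg h0).symm

/-- The diagonal of an operator in any orthonormal basis is bounded by the trace norm. -/
theorem sum_norm_inner_le_traceNorm (e : OrthonormalBasis ι ℂ H) (A : Op H) :
    ∑ i, ‖⟪e i, A (e i)⟫_ℂ‖ ≤ traceNorm A := by
  obtain ⟨f, hf⟩ := traceNorm_eq_sum_norm A
  -- Expanding in the eigenbasis of `|A|` leaves, for each `k`, a Cauchy-Schwarz estimate over `i`.
  have hexp : ∀ i, ⟪e i, A (e i)⟫_ℂ = ∑ k, ⟪f k, e i⟫_ℂ * ⟪e i, A (f k)⟫_ℂ := by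
    intro i
    conv_lhs => rw [show A (e i) = ∑ k, ⟪f k, e i⟫_ℂ • A (f k) by
      conv_lhs => rw [← f.sum_repr' (e i)]
      simp]
    simp
  calc ∑ i, ‖⟪e i, A (e i)⟫_ℂ‖
      ≤ ∑ i, ∑ k, ‖⟪e i, f k⟫_ℂ‖ * ‖⟪e i, A (f k)⟫_ℂ‖ := by
        refine Finset.sum_le_sum fun i _ ↦ ?_
        rw [hexp]
        refine (norm_sum_le _ _).trans_eq (Finset.sum_congr rfl fun k _ ↦ ?_)
        rw [norm_mul, norm_inner_symm]
    _ = ∑ k, ∑ i, ‖⟪e i, f k⟫_ℂ‖ * ‖⟪e i, A (f k)⟫_ℂ‖ := Finset.sum_comm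
    _ ≤ ∑ k, ‖A (f k)‖ := by
        refine Finset.sum_le_sum fun k _ ↦ ?_
        have := Real.sum_mul_le_sqrt_mul_sqrt Finset.univ (fun i ↦ ‖⟪e i, f k⟫_ℂ‖)
          (fun i ↦ ‖⟪e i, A (f k)⟫_ℂ‖)
        rwa [e.sum_sq_norm_inner_right, e.sum_sq_norm_inner_right, Real.sqrt_sq (norm_nonneg _),
          Real.sqrt_sq (norm_nonneg _), f.norm_eq_one, one_mul] at this
    _ = traceNorm A := hf.symm

variable {X : Type*} [Fintype X]

/-- Each eigenprojection of `A` is sent to a state, hence to a probability distribution, so the left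
side is at most the sum of `|l i|`. The eigenvalues are diagonal entries of `∑ c j • B j`, so they
can be bounded term by term; this avoids the triangle inequality for the trace norm and allows
non-Hermitian `B j`. -/
theorem sum_abs_re_tr_mul_le {E : X → Op H} (hE : IsPOVM E) {T : SuperOp H} (hT : IsCPTP T)
    {A : Op H} (hA : IsSelfAdjoint A) {J : Type*} [Fintype J] (c : J → ℝ) (B : J → Op H)
    (hAB : A = ∑ j, (c j : ℂ) • B j) :
    ∑ x, |(tr (E x * T A)).re| ≤ ∑ j, |c j| * traceNorm (B j) := by
  obtain ⟨e, l, he⟩ := exists_orthonormalBasis_apply_eq_smul hA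
  let R : Fin (Module.finrank ℂ H) → Op H := fun i ↦ InnerProductSpace.rankOne ℂ (e i) (e i)
  have hR0 : ∀ i, 0 ≤ R i := fun i ↦
    (ContinuousLinearMap.nonneg_iff_isPositive _).2 (InnerProductSpace.isPositive_rankOne_self _)
  have hAR : A = ∑ i, (l i : ℂ) • R i := by
    ext v
    conv_lhs => rw [← e.sum_repr' v]
    simp only [map_sum, map_smul, he]
    simp only [R, FunLike.coe_sum, Finset.sum_apply, FunLike.coe_smul, Pi.smul_apply,
      InnerProductSpace.rankOne_apply]
    exact Finset.sum_congr rfl fun i _ ↦ smul_comm _ _ _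
  have hTA : ∀ x, (tr (E x * T A)).re = ∑ i, l i * (tr (E x * T (R i))).re := by
    intro x
    conv_lhs => rw [hAR]
    rw [map_sum, Finset.mul_sum, tr_sum, Complex.re_sum]
    refine Finset.sum_congr rfl fun i _ ↦ ?_
    rw [map_smul, mul_smul_comm, tr_smul, Complex.re_ofReal_mul]
  have hsum : ∀ i, ∑ x, (tr (E x * T (R i))).re = 1 := by
    intro i
    rw [← Complex.re_sum, ← tr_sum, ← Finset.sum_mul, hE.2, one_mul, hT.2,
      tr_rankOne_self _ (e.norm_eq_one i), Complex.one_re]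
  have hl : ∀ i, |l i| ≤ ∑ j, |c j| * ‖⟪e i, B j (e i)⟫_ℂ‖ := by
    intro i
    have h1 : ⟪e i, A (e i)⟫_ℂ = (l i : ℂ) := by
      rw [he, inner_smul_right, inner_self_eq_norm_sq_to_K, e.norm_eq_one]; simp
    have h2 : ⟪e i, A (e i)⟫_ℂ = ∑ j, (c j : ℂ) * ⟪e i, B j (e i)⟫_ℂ := by
      conv_lhs => rw [hAB]
      simp
    calc |l i| = ‖(l i : ℂ)‖ := by simp
      _ = ‖∑ j, (c j : ℂ) * ⟪e i, B j (e i)⟫_ℂ‖ := by rw [← h1, h2]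
      _ ≤ _ := (norm_sum_le _ _).trans_eq (by simp)
  calc ∑ x, |(tr (E x * T A)).re| ≤ ∑ x, ∑ i, |l i| * (tr (E x * T (R i))).re := by
        refine Finset.sum_le_sum fun x _ ↦ ?_
        rw [hTA]
        refine (Finset.abs_sum_le_sum_abs _ _).trans_eq (Finset.sum_congr rfl fun i _ ↦ ?_)
        rw [abs_mul, abs_of_nonneg (re_tr_mul_nonneg (hE.1 x) (hT.nonneg (hR0 i)))]
    _ = ∑ i, |l i| := by
        rw [Finset.sum_comm]
        refine Finset.sum_congr rfl fun i _ ↦ ?_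
        rw [← Finset.mul_sum, hsum, mul_one]
    _ ≤ ∑ i, ∑ j, |c j| * ‖⟪e i, B j (e i)⟫_ℂ‖ := Finset.sum_le_sum fun i _ ↦ hl i
    _ = ∑ j, |c j| * ∑ i, ‖⟪e i, B j (e i)⟫_ℂ‖ := by
        rw [Finset.sum_comm]; simp_rw [Finset.mul_sum]
    _ ≤ _ := Finset.sum_le_sum fun j _ ↦ mul_le_mul_of_nonneg_left
        (sum_norm_inner_le_traceNorm e (B j)) (abs_nonneg _)

end OperatorTrace

/-! ### Duhamel perturbation bound for the output distribution -/

section Perturbation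

variable {H : Type*} [NormedAddCommGroup H] [InnerProductSpace ℂ H] [CompleteSpace H]

theorem evolution_zero (L : SuperOp H) : evolution L 0 = 1 := by
  simp [evolution]

theorem hasDerivAt_evolution (L : SuperOp H) (s : ℝ) :
    HasDerivAt (evolution L) (L * evolution L s) s := by
  have h := (hasDerivAt_exp_smul_const' L (s : ℂ)).scomp s Complex.ofRealCLM.hasDerivAt
  rw [Complex.ofRealCLM_apply, Complex.ofReal_one, one_smul] at h
  exact h

theorem hasDerivAt_evolution' (L : SuperOp H) (s : ℝ) :
    HasDerivAt (evolution L) (evolution L s * L) s := by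
  have h := (hasDerivAt_exp_smul_const L (s : ℂ)).scomp s Complex.ofRealCLM.hasDerivAt
  rw [Complex.ofRealCLM_apply, Complex.ofReal_one, one_smul] at h
  exact h

/-- Duhamel's formula in differential form. -/
theorem hasDerivAt_evolution_mul_evolution (L L' : SuperOp H) (t s : ℝ) :
    HasDerivAt (fun s ↦ evolution L (t - s) * evolution L' s)
      (evolution L (t - s) * (L' - L) * evolution L' s) s := by
  have h1 : HasDerivAt (fun s ↦ evolution L (t - s)) (-(evolution L (t - s) * L)) s := by
    have h := (hasDerivAt_evolution' L (t - s)).scomp s ((hasDerivAt_id s).const_sub t)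
    rw [neg_one_smul] at h
    exact h
  have h2 := h1.mul (hasDerivAt_evolution L' s)
  exact h2.congr_deriv (by noncomm_ring)

variable [FiniteDimensional ℂ H] {X : Type*} [Fintype X]

theorem sum_abs_outputDist_sub_le {E : X → Op H} (hE : IsPOVM E) {L L' : SuperOp H}
    (hL : IsGKSL L) (hL' : IsGKSL L') {ρ : Op H} (hρ : IsState ρ) {t : ℝ} (ht : 0 ≤ t)
    {J : Type*} [Fintype J] (c : J → ℝ) (G : J → SuperOp H)
    (hLL' : L' - L = ∑ j, (c j : ℂ) • G j) {C : ℝ} (hC : 0 < C)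
    (hG : ∀ j, inducedOneNorm (G j) ≤ ENNReal.ofReal C) :
    ∑ x, |outputDist t ρ E L' x - outputDist t ρ E L x| ≤ t * (C * ∑ j, |c j|) := by
  -- Freezing the signs of the final difference makes the `ℓ¹` distance a linear functional of the
  -- evolution, so a scalar mean value inequality suffices.
  let sg : X → ℝ := fun x ↦ SignType.sign (outputDist t ρ E L' x - outputDist t ρ E L x)
  have hsg : ∀ x, |sg x| ≤ 1 := by
    intro x
    rcases lt_trichotomy (outputDist t ρ E L' x - outputDist t ρ E L x) 0 with h | h | h <;>
      simp [sg, h]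
  let φ : SuperOp H →ₗ[ℝ] ℝ :=
    { toFun := fun T ↦ ∑ x, sg x * (tr (E x * T ρ)).re
      map_add' := fun S T ↦ by
        simp [mul_add, tr_add, Finset.sum_add_distrib]
      map_smul' := fun r T ↦ by
        have : ∀ x, E x * (r • T) ρ = (r : ℂ) • (E x * T ρ) := fun x ↦ by
          rw [← Complex.coe_smul]; simp
        simp only [this, tr_smul, Complex.re_ofReal_mul, smul_eq_mul,
          RingHom.id_apply, Finset.mul_sum]
        exact Finset.sum_congr rfl fun x _ ↦ by ring }
  have : FiniteDimensional ℝ (SuperOp H) := FiniteDimensional.complexToReal _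
  let ψ : SuperOp H →L[ℝ] ℝ := LinearMap.toContinuousLinearMap φ
  have hψ : ∀ T : SuperOp H, ψ T = ∑ x, sg x * (tr (E x * T ρ)).re := fun T ↦ rfl
  have hder : ∀ s, HasDerivAt (fun s ↦ ψ (evolution L (t - s) * evolution L' s))
      (ψ (evolution L (t - s) * (L' - L) * evolution L' s)) s := fun s ↦
    ψ.hasFDerivAt.comp_hasDerivAt s (hasDerivAt_evolution_mul_evolution L L' t s)
  have hbd : ∀ s ∈ Set.Ico 0 t, ‖ψ (evolution L (t - s) * (L' - L) * evolution L' s)‖ ≤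
      C * ∑ j, |c j| := by
    intro s hs
    have hσ : IsState (evolution L' s ρ) := hρ.map (hL'.isCPTP_evolution s hs.1)
    have hσs : IsSelfAdjoint (evolution L' s ρ) := IsSelfAdjoint.of_nonneg hσ.1
    have hsa : IsSelfAdjoint ((L' - L) (evolution L' s ρ)) :=
      (hL'.isSelfAdjoint_map _ hσs).sub (hL.isSelfAdjoint_map _ hσs)
    have h1 := sum_abs_re_tr_mul_le hE (hL.isCPTP_evolution (t - s) (by linarith [hs.2])) hsa c
      (fun j ↦ G j (evolution L' s ρ)) (by rw [hLL']; simp)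
    rw [hψ, Real.norm_eq_abs]
    calc _ ≤ ∑ x, |(tr (E x * evolution L (t - s) ((L' - L) (evolution L' s ρ)))).re| := by
          refine (Finset.abs_sum_le_sum_abs _ _).trans (Finset.sum_le_sum fun x _ ↦ ?_)
          rw [abs_mul]
          exact mul_le_of_le_one_left (abs_nonneg _) (hsg x)
      _ ≤ _ := h1
      _ ≤ ∑ j, |c j| * C := Finset.sum_le_sum fun j _ ↦ mul_le_mul_of_nonneg_left
          (traceNorm_apply_le_of_isState hC (hG j) hσ) (abs_nonneg _)
      _ = _ := by rw [← Finset.sum_mul, mul_comm]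
  -- The path runs from `e^{tL}` at `s = 0` to `e^{tL'}` at `s = t`.
  have hmv := norm_image_sub_le_of_norm_deriv_le_segment'
    (fun s _ ↦ (hder s).hasDerivWithinAt) hbd t ⟨ht, le_rfl⟩
  simp only [sub_self, sub_zero, evolution_zero, one_mul, mul_one] at hmv
  calc ∑ x, |outputDist t ρ E L' x - outputDist t ρ E L x|
      = ψ (evolution L' t) - ψ (evolution L t) := by
        rw [hψ, hψ, ← Finset.sum_sub_distrib]
        refine Finset.sum_congr rfl fun x _ ↦ ?_
        rw [← mul_sub]
        exact (sign_mul_self _).symm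
    _ ≤ _ := (le_abs_self _).trans hmv
    _ = _ := mul_comm _ _

theorem abs_dTV_sub_dTV_le (P P' Q : X → ℝ) :
    |dTV P Q - dTV P' Q| ≤ (1 / 2) * ∑ x, |P x - P' x| := by
  rw [dTV, dTV, ← mul_sub, abs_mul, ← Finset.sum_sub_distrib, abs_of_pos one_half_pos]
  gcongr
  refine (Finset.abs_sum_le_sum_abs _ _).trans (Finset.sum_le_sum fun x _ ↦ ?_)
  refine (abs_abs_sub_abs_le_abs_sub _ _).trans_eq ?_
  ring_nf

/-- The total variation distance to a reference distribution is Lipschitz in the parameter. -/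
theorem abs_tvToRef_sub_tvToRef_le {M : ℕ} {Lref : SuperOp H} {G : Fin M → SuperOp H}
    {δ t C : ℝ} (hδ : 0 < δ) (ht : 0 ≤ t) (hC : 0 < C) {ρ : Op H} {E : X → Op H} (Q : X → ℝ)
    (hG : ∀ j, inducedOneNorm (G j) ≤ ENNReal.ofReal C) (hρ : IsState ρ) (hE : IsPOVM E)
    {θ θ' : ParamSphere M} (hθ : IsGKSL (generator Lref G δ θ))
    (hθ' : IsGKSL (generator Lref G δ θ')) :
    |tvToRef Lref G δ t ρ E Q θ - tvToRef Lref G δ t ρ E Q θ'| ≤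
      (t * δ * C / 2) * dist θ θ' := by
  set u := (θ : EuclideanSpace ℝ (Fin M))
  set u' := (θ' : EuclideanSpace ℝ (Fin M))
  have hM : (0 : ℝ) < M := by
    rcases Nat.eq_zero_or_pos M with rfl | h
    · have h1 : ‖u‖ = 1 := by simp [u]
      rw [Subsingleton.elim u 0, norm_zero] at h1
      exact absurd h1 zero_ne_one
    · exact_mod_cast h
  have hdiff : generator Lref G δ θ - generator Lref G δ θ' =
      ∑ j, ((δ / √M * (u j - u' j) : ℝ) : ℂ) • G j := by
    simp only [generator, add_sub_add_left_eq_sub, ← Finset.sum_sub_distrib,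
      ← sub_smul, Finset.smul_sum, smul_smul]
    push_cast
    simp only [mul_sub, u, u']
  have h1 := sum_abs_outputDist_sub_le hE hθ' hθ hρ ht _ G hdiff hC hG
  -- Cauchy-Schwarz; this `√M` cancels the normalization of the generator.
  have h2 : ∑ j, |u j - u' j| ≤ √M * dist θ θ' := by
    rw [Subtype.dist_eq, dist_eq_norm]
    refine abs_le_of_sq_le_sq' ?_ (by positivity) |>.2
    rw [mul_pow, Real.sq_sqrt hM.le, EuclideanSpace.real_norm_sq_eq]
    simpa using sq_sum_le_card_mul_sum_sq (s := Finset.univ) (f := fun j ↦ |u j - u' j|)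
  calc _ ≤ (1 / 2) * ∑ x, |outputDist t ρ E (generator Lref G δ θ) x -
          outputDist t ρ E (generator Lref G δ θ') x| := abs_dTV_sub_dTV_le _ _ _
    _ ≤ (1 / 2) * (t * (C * ∑ j, |δ / √M * (u j - u' j)|)) := by gcongr
    _ = (1 / 2) * (t * (C * (δ / √M * ∑ j, |u j - u' j|))) := by
        simp_rw [abs_mul, abs_of_pos (div_pos hδ (Real.sqrt_pos.2 hM)), ← Finset.mul_sum]
    _ ≤ (1 / 2) * (t * (C * (δ / √M * (√M * dist θ θ')))) := by gcongr
    _ = _ := by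
        have : √(M : ℝ) ≠ 0 := (Real.sqrt_pos.2 hM).ne'
        field_simp

end Perturbation

/-! ### Concentration on a parameter set of full measure -/

section Concentration

theorem isProbabilityMeasure_sphereMeasure {M : ℕ} (hM : 1 ≤ M) :
    IsProbabilityMeasure (sphereMeasure M) := (exists_stdGaussian_eq_map_smul M hM).1

theorem paramMeasure_eq_sphereMeasure {M : ℕ} (hM : 1 ≤ M) {Θ : Set (ParamSphere M)}
    (hΘ : ∀ᵐ θ ∂sphereMeasure M, θ ∈ Θ) : paramMeasure Θ = sphereMeasure M := by
  have := isProbabilityMeasure_sphereMeasure hM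
  have h1 : sphereMeasure M Θ = 1 := by
    rw [← measure_univ (μ := sphereMeasure M)]
    exact measure_congr (Filter.eventuallyEq_univ.2 hΘ)
  rw [paramMeasure, h1, inv_one, one_smul, Measure.restrict_eq_self_of_ae_mem hΘ]

/-- Lévy's inequality around an approximate mean, for functions that are Lipschitz on a set of
full measure. -/
theorem IsLevyConstant.measureReal_le_of_ae_mem {c : ℝ} (hc : IsLevyConstant c) {M : ℕ}
    (hM : 1 ≤ M) {Θ : Set (ParamSphere M)} (hΘ : ∀ᵐ θ ∂sphereMeasure M, θ ∈ Θ)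
    {f : ParamSphere M → ℝ} {L : ℝ} (hL : 0 < L)
    (hf : ∀ θ ∈ Θ, ∀ θ' ∈ Θ, |f θ - f θ'| ≤ L * dist θ θ') {m₀ ε : ℝ}
    (hmean : ∫ θ, f θ ∂sphereMeasure M ∈ Set.Icc (m₀ - ε) (m₀ + ε)) {ξ : ℝ} (hξ : 0 < ξ) :
    (sphereMeasure M).real {θ | ξ + ε ≤ |f θ - m₀|} ≤
      2 * Real.exp (-c * (M * ξ ^ 2 / L ^ 2)) := by
  have := isProbabilityMeasure_sphereMeasure hM
  have hlip : LipschitzOnWith L.toNNReal f Θ := LipschitzOnWith.of_dist_le_mul fun θ hθ θ' hθ' ↦ by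
    rw [Real.coe_toNNReal _ hL.le, Real.dist_eq]; exact hf θ hθ θ' hθ'
  -- The extension keeps the same constant and agrees with `f` almost everywhere, so neither the
  -- mean nor the deviation probability changes.
  obtain ⟨g, hg, hfg⟩ := hlip.extend_real
  have hae : f =ᵐ[sphereMeasure M] g := hΘ.mono fun θ hθ ↦ hfg hθ
  have hset : ({θ | ξ + ε ≤ |f θ - m₀|} : Set (ParamSphere M)) =ᵐ[sphereMeasure M]
      ({θ | ξ + ε ≤ |g θ - m₀|} : Set (ParamSphere M)) := by
    refine Filter.eventuallyEq_set.2 (hae.mono fun θ hθ ↦ ?_)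
    simp [hθ]
  rw [integral_congr_ae hae] at hmean
  rw [measureReal_congr hset]
  refine (measureReal_mono fun θ hθ ↦ ?_).trans (hc M hM g L ξ hL hξ fun θ θ' ↦ by
    simpa [Real.dist_eq, hL.le] using hg.dist_le_mul θ θ')
  have h1 : ξ + ε ≤ |g θ - m₀| := hθ
  have h2 : |∫ η, g η ∂sphereMeasure M - m₀| ≤ ε := by
    rw [abs_le]; constructor <;> linarith [hmean.1, hmean.2]
  have h3 := abs_sub_le (g θ) (∫ η, g η ∂sphereMeasure M) m₀
  change ξ ≤ |g θ - ∫ η, g η ∂sphereMeasure M|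
  linarith

end Concentration

end OpenSystem
end

theorem mainTheorem6 :
    ∃ c_par : ℝ, 0 < c_par ∧ OpenSystem.IsLevyConstant c_par ∧
      ∀ (H : Type*) [NormedAddCommGroup H] [InnerProductSpace ℂ H] [FiniteDimensional ℂ H]
        [CompleteSpace H] (X : Type*) [Fintype X] (M : ℕ)
        (Lref : OpenSystem.SuperOp H) (G : Fin M → OpenSystem.SuperOp H) (δ t C_G : ℝ)
        (Θ : Set (OpenSystem.ParamSphere M))
        (ρ : OpenSystem.Op H) (E : X → OpenSystem.Op H) (Q : X → ℝ),
        0 < δ → 0 < t → 0 < C_G →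
        OpenSystem.IsGKSL Lref →
        Θ.Nonempty →
        (∀ θ ∈ Θ, OpenSystem.IsGKSL (OpenSystem.generator Lref G δ θ)) →
        (∀ j, OpenSystem.inducedOneNorm (G j) ≤ ENNReal.ofReal C_G) →
        OpenSystem.IsState ρ → OpenSystem.IsPOVM E → Q ∈ stdSimplex ℝ X →
        -- Lipschitz bound on the parameter set, with constant `L_TV = L₀ / 2`, `L₀ = t δ C_G`
        (∀ θ ∈ Θ, ∀ θ' ∈ Θ,
          |OpenSystem.tvToRef Lref G δ t ρ E Q θ - OpenSystem.tvToRef Lref G δ t ρ E Q θ'|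
            ≤ (t * δ * C_G / 2) * dist θ θ') ∧
        -- `Θ` of full measure, and the mean assumption
        ∀ m₀ ε : ℝ, 0 < m₀ →
          (∀ᵐ θ ∂OpenSystem.sphereMeasure M, θ ∈ Θ) →
          (∫ θ, OpenSystem.tvToRef Lref G δ t ρ E Q θ ∂OpenSystem.paramMeasure Θ)
            ∈ Set.Icc (m₀ - ε) (m₀ + ε) →
          -- concentration around `m₀`
          (∀ ξ : ℝ, 0 < ξ →
            (OpenSystem.paramMeasure Θ).real
                {θ | ξ + ε ≤ |OpenSystem.tvToRef Lref G δ t ρ E Q θ - m₀|}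
              ≤ 2 * Real.exp (-c_par * (M * ξ ^ 2 / (t * δ * C_G / 2) ^ 2))) ∧
          -- typicality of being far from `Q`
          (ε ≤ m₀ / 4 →
            {θ | OpenSystem.tvToRef Lref G δ t ρ E Q θ ≤ m₀ / 2}
              ⊆ {θ | m₀ / 2 ≤ |OpenSystem.tvToRef Lref G δ t ρ E Q θ - m₀|} ∧
            (OpenSystem.paramMeasure Θ).real
                {θ | OpenSystem.tvToRef Lref G δ t ρ E Q θ ≤ m₀ / 2}
              ≤ 2 * Real.exp
                  (-c_par * (M * m₀ ^ 2 / (16 * (t * δ * C_G / 2) ^ 2)))) := by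
  obtain ⟨c, hc0, hc⟩ := OpenSystem.exists_isLevyConstant
  refine ⟨c, hc0, hc, ?_⟩
  intro H _ _ _ _ X _ M Lref G δ t C_G Θ ρ E Q hδ ht hC _ hΘne hΘ hG hρ hE _
  -- The unit sphere of `ℝ^0` is empty, so a point of `Θ` excludes `M = 0`.
  have hM : 1 ≤ M := by
    obtain ⟨θ, -⟩ := hΘne
    rcases Nat.eq_zero_or_pos M with rfl | h
    · have h1 : ‖(θ : EuclideanSpace ℝ (Fin 0))‖ = 1 := by simp
      rw [Subsingleton.elim (θ : EuclideanSpace ℝ (Fin 0)) 0, norm_zero] at h1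
      exact absurd h1 zero_ne_one
    · exact h
  have hlip : ∀ θ ∈ Θ, ∀ θ' ∈ Θ,
      |OpenSystem.tvToRef Lref G δ t ρ E Q θ - OpenSystem.tvToRef Lref G δ t ρ E Q θ'|
        ≤ (t * δ * C_G / 2) * dist θ θ' := fun θ hθ θ' hθ' ↦
    OpenSystem.abs_tvToRef_sub_tvToRef_le hδ ht.le hC Q hG hρ hE (hΘ θ hθ) (hΘ θ' hθ')
  refine ⟨hlip, ?_⟩
  intro m₀ ε hm₀ hae hmean
  have hprob := OpenSystem.isProbabilityMeasure_sphereMeasure hM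
  rw [OpenSystem.paramMeasure_eq_sphereMeasure hM hae] at hmean ⊢
  have hconc := fun (ξ : ℝ) (hξ : 0 < ξ) ↦
    hc.measureReal_le_of_ae_mem hM hae (by positivity) hlip hmean hξ
  refine ⟨hconc, fun hε ↦ ⟨fun θ hθ ↦ ?_, ?_⟩⟩
  · have h1 : OpenSystem.tvToRef Lref G δ t ρ E Q θ ≤ m₀ / 2 := hθ
    change m₀ / 2 ≤ |OpenSystem.tvToRef Lref G δ t ρ E Q θ - m₀|
    rw [le_abs]; right; linarith
  -- With `ξ = m₀ / 4` the threshold `ξ + ε` is at most `m₀ / 2`; squaring `m₀ / 4` gives the `16`.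
  · refine (measureReal_mono fun θ hθ ↦ ?_).trans ((hconc (m₀ / 4) (by positivity)).trans_eq ?_)
    · have h1 : OpenSystem.tvToRef Lref G δ t ρ E Q θ ≤ m₀ / 2 := hθ
      change m₀ / 4 + ε ≤ |OpenSystem.tvToRef Lref G δ t ρ E Q θ - m₀|
      rw [le_abs]; right; linarith
    · congr 3
      field_simp
      ring
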